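/- Consider a single-link two-sided queue: customers and servers wait in two queues of lengths $q^{(2)}$ and $q^{(1)}$, and a waiting customer and a waiting server can be matched, upon which both leave. In every state the operator posts a customer price and a server price; the customer price $F(\lambda)$ induces Poisson customer arrivals of rate $\lambda\in[0,\lambda_{\max}]$, and the server price $G(\mu)$ induces Poisson server arrivals of rate $\mu\in[0,\mu_{\max}]$, where $\lambda_{\max},\mu_{\max}>0$. The demand curve $F:[0,\lambda_{\max}]\to\mathbb R$ is strictly decreasing, the supply curve $G:[0,\mu_{\max}]\to\mathbb R$ is strictly increasing, both are continuous, and twice continuously differentiable in the interior of their domains; $\lambda\mapsto\lambda F(\lambda)$ is concave and $\mu\mapsto\mu G(\mu)$ is convex. The operator earns the customer price at each customer arrival, pays the server price at each server arrival, and pays a holding cost $s>0$ per waiting customer or server and unit of time. A (stationary, joint pricing and matching) policy chooses, as functions of the queue lengths, the rates $\lambda,\mu$ (that is, the prices) and, at each arrival, how many customer-server pairs to match. The system is studied through its uniformized chain with a constant $c\ge\lambda_{\max}+\mu_{\max}$: in each period a customer arrives with probability $\lambda/c$, a server with probability $\mu/c$, and nothing happens otherwise. A policy is stable if the empty system is a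 positive recurrent state of this chain. It is optimal if it is stable and, from every initial state in which customers and servers are not waiting simultaneously, its long-run expected average profit $$\liminf_{N\to\infty}\frac1N\sum_{k<N}\mathbb E\big[\lambda F(\lambda)-\mu G(\mu)-s(q^{(1)}+q^{(2)})\big]_{\text{period }k}$$ is at least that of every stable policy. Then there is a pricing policy $q\mapsto(p^{(1)}(q),p^{(2)}(q))=(G(\mu^*(q)),F(\lambda^*(q)))$ depending only on the imbalance $q=q^{(2)}-q^{(1)}\in\mathbb Z$ such that (i) together with immediate matching (match whenever possible) it is optimal; (ii) for some $\gamma\in\mathbb R$ and $h:\mathbb Z\to\mathbb R$, the Bellman equation $$h(q)=\max_{0\le\lambda\le\lambda_{\max},\,0\le\mu\le\mu_{\max}}\Big[\tfrac{F(\lambda)\lambda-G(\mu)\mu}{c}-\tfrac{s|q|}{c}-\tfrac{\gamma}{c}+\tfrac{\lambda}{c}h(q+1)+\big(1-\tfrac{\mu+\lambda}{c}\big)h(q)+\tfrac{\mu}{c}h(q-1)\Big]$$ holds for all $q\in\mathbb Z$, the rates $(\lambda^*(q),\mu^*(q))$ attain the maximum for every $q$, and $\gamma$ is the long-run average profit of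 the policy in (i) from every initial state in which customers and servers are not waiting simultaneously; (iii) both the server price $p^{(1)}(q)$ and the customer price $p^{(2)}(q)$ are (weakly) increasing in $q$. -/

import Mathlib

open Set Filter Topology

noncomputable section

/-- A single-link two-sided queue (one customer type, one server type), with its standing
assumptions.  Arrival rates are the actions: charging customers the price `demand lam` makes
customers arrive at rate `lam`, paying servers the price `supply mu` makes servers arrive at rate
`mu`. -/
structure SingleLinkQueue where
  /-- the demand curve `F`, with domain `[0, lamMax]` -/
  demand : ℝ → ℝ
  /-- the supply curve `G`, with domain `[0, muMax]` -/
  supply : ℝ → ℝ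
  /-- the largest customer arrival rate -/
  lamMax : ℝ
  /-- the largest server arrival rate -/
  muMax : ℝ
  /-- the holding cost per waiting customer or server and unit of time -/
  holding : ℝ
  /-- the uniformization constant -/
  unif : ℝ
  lamMax_pos : 0 < lamMax
  muMax_pos : 0 < muMax
  holding_pos : 0 < holding
  unif_ge : lamMax + muMax ≤ unif
  demand_strictAnti : StrictAntiOn demand (Icc 0 lamMax)
  supply_strictMono : StrictMonoOn supply (Icc 0 muMax)
  demand_continuous : ContinuousOn demand (Icc 0 lamMax)
  supply_continuous : ContinuousOn supply (Icc 0 muMax)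
  demand_contDiff : ContDiffOn ℝ 2 demand (Ioo 0 lamMax)
  supply_contDiff : ContDiffOn ℝ 2 supply (Ioo 0 muMax)
  revenue_concave : ConcaveOn ℝ (Icc 0 lamMax) (fun lam => lam * demand lam)
  cost_convex : ConvexOn ℝ (Icc 0 muMax) (fun mu => mu * supply mu)

namespace SingleLinkQueue

/-- A state is a pair `(q₁, q₂)`: `q₁` servers and `q₂` customers are waiting. -/
abbrev State : Type := ℕ × ℕ

/-- A joint (stationary) pricing and matching policy.  In state `x` the prices are set so that
customers and servers arrive at rates `lam x` and `mu x`; if an arrival brings the queue lengths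
to `x`, then `matched x` customer-server pairs are matched and leave. -/
structure Policy (Q : SingleLinkQueue) where
  lam : State → ℝ
  mu : State → ℝ
  matched : State → ℕ
  lam_mem : ∀ x, lam x ∈ Icc 0 Q.lamMax
  mu_mem : ∀ x, mu x ∈ Icc 0 Q.muMax
  matched_le : ∀ x, matched x ≤ min x.1 x.2

namespace Policy

variable {Q : SingleLinkQueue}

/-- The state after matching, if an arrival has brought the queue lengths to `x`. -/
def settle (π : Policy Q) (x : State) : State :=
  (x.1 - π.matched x, x.2 - π.matched x)

/-- One period of the uniformized chain `X` induced by `π`: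
`π.step f x = E[f (X (k + 1)) | X k = x]`.  A customer arrives with probability `lam x / c`, a
server with probability `mu x / c`, and nothing happens otherwise. -/
def step (π : Policy Q) (f : State → ℝ) (x : State) : ℝ :=
  π.lam x / Q.unif * f (π.settle (x.1, x.2 + 1))
    + π.mu x / Q.unif * f (π.settle (x.1 + 1, x.2))
    + (1 - (π.lam x + π.mu x) / Q.unif) * f x

/-- `π.expect k f x = E[f (X k) | X 0 = x]`. -/
def expect (π : Policy Q) (k : ℕ) (f : State → ℝ) (x : State) : ℝ :=
  (π.step^[k]) f x

/-- The expected profit per unit of time earned in state `x`. -/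
def profit (π : Policy Q) (x : State) : ℝ :=
  π.lam x * Q.demand (π.lam x) - π.mu x * Q.supply (π.mu x)
    - Q.holding * ((x.1 : ℝ) + (x.2 : ℝ))

/-- The long-run expected average profit (per unit of time) earned from initial state `x`. -/
def averageProfit (π : Policy Q) (x : State) : EReal :=
  liminf (fun N : ℕ => (((∑ k ∈ Finset.range N, π.expect k π.profit x) / (N : ℝ) : ℝ) : EReal))
    atTop

/-- `π.noReturn n x = P(X 1 ≠ 0, …, X n ≠ 0 | X 0 = x)`, where `0` is the empty system. -/
def noReturn (π : Policy Q) : ℕ → State → ℝ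
  | 0 => fun _ => 1
  | n + 1 => π.step (fun y => if y = 0 then 0 else π.noReturn n y)

/-- A policy is stable if the empty system is a positive recurrent state, that is, if its expected
return time `∑ n, P(X 1 ≠ 0, …, X n ≠ 0 | X 0 = 0)` is finite. -/
def Stable (π : Policy Q) : Prop :=
  Summable (fun n : ℕ => π.noReturn n 0)

/-- A policy is optimal if it is stable and no stable policy has a larger long-run average profit,
from any initial state in which customers and servers are not waiting simultaneously. -/
def IsOptimal (π : Policy Q) : Prop :=
  π.Stable ∧ ∀ π' : Policy Q, π'.Stable →
    ∀ x : State, (x.1 = 0 ∨ x.2 = 0) → π'.averageProfit x ≤ π.averageProfit x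

end Policy

/-- A pricing policy that depends on the imbalance `q = q₂ - q₁` only, given through the arrival
rates that its prices induce. -/
structure PricingPolicy (Q : SingleLinkQueue) where
  lam : ℤ → ℝ
  mu : ℤ → ℝ
  lam_mem : ∀ q, lam q ∈ Icc 0 Q.lamMax
  mu_mem : ∀ q, mu q ∈ Icc 0 Q.muMax

namespace PricingPolicy

variable {Q : SingleLinkQueue}

/-- The price paid to servers. -/
def serverPrice (p : PricingPolicy Q) (q : ℤ) : ℝ := Q.supply (p.mu q)

/-- The price charged to customers. -/
def customerPrice (p : PricingPolicy Q) (q : ℤ) : ℝ := Q.demand (p.lam q)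

/-- The joint policy that prices according to `p` and matches whenever possible. -/
def withImmediateMatching (p : PricingPolicy Q) : Policy Q where
  lam x := p.lam ((x.2 : ℤ) - (x.1 : ℤ))
  mu x := p.mu ((x.2 : ℤ) - (x.1 : ℤ))
  matched x := min x.1 x.2
  lam_mem _ := p.lam_mem _
  mu_mem _ := p.mu_mem _
  matched_le _ := le_rfl

end PricingPolicy

/-- The expression that is maximized over `lam` and `mu` in the Bellman equation at imbalance
`q`. -/
def bellmanValue (Q : SingleLinkQueue) (γ : ℝ) (h : ℤ → ℝ) (q : ℤ) (lam mu : ℝ) : ℝ :=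
  (Q.demand lam * lam - Q.supply mu * mu) / Q.unif - Q.holding * |(q : ℝ)| / Q.unif - γ / Q.unif
    + lam / Q.unif * h (q + 1) + (1 - (mu + lam) / Q.unif) * h q + mu / Q.unif * h (q - 1)

/-- `(γ, h)` solves the Bellman equation `h q = max_{lam, mu} bellmanValue Q γ h q lam mu`, and
in every state the rates of `p` attain the maximum. -/
def PricingPolicy.SolvesBellman {Q : SingleLinkQueue} (p : PricingPolicy Q) (γ : ℝ)
    (h : ℤ → ℝ) : Prop :=
  ∀ q : ℤ, h q = bellmanValue Q γ h q (p.lam q) (p.mu q) ∧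
    ∀ lam ∈ Icc 0 Q.lamMax, ∀ mu ∈ Icc 0 Q.muMax, bellmanValue Q γ h q lam mu ≤ h q

end SingleLinkQueue

end

/-! Put `d q = h (q - 1) - h q`. The maximization in the Bellman equation separates into a server
and a customer problem with values `ψ₁ x = max μ (x - G μ)` and `ψ₂ x = max λ (x + F λ)`, and the
equation becomes `ψ₂ (-d (q + 1)) + ψ₁ (d q) = γ + s |q|`. Far to the right the first term vanishes
and far to the left the second does, so on each half-line the recursion can be solved inwards from a
finite place (`exists_halfline_solution`). The equation at `q = 0` then fixes `γ` by the
intermediate value theorem. The resulting `d` is increasing (`exists_monotone_increments`), so `h`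
is concave; maximizing rates are monotone in the increments, which gives the monotone prices.

Optimality is a verification argument. Since `d` is unbounded, `h` grows too fast to bound the
profit of an arbitrary policy. Clipping `d` to a bounded interval gives a supersolution `w` of
linear growth; its boundary term is controlled because a policy whose expected queue grows pays for
it in holding costs (`liminf_average_le`). Hence every policy earns at most `γ`. Conversely `h` is
bounded above and solves the equation exactly under the constructed policy, which therefore earns at
least `γ`. Stability is Foster's criterion (`Policy.stable_of_lyapunov`): inward rates are bounded
below, and outward rates vanish far out. -/

/-! ### Surplus functions of the one-sided pricing problems. -/

/-- `m x` maximizes `μ * (x - G μ)` over `μ ∈ [0, M]`. -/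
structure IsSurplusRate (G : ℝ → ℝ) (M : ℝ) (m : ℝ → ℝ) : Prop where
  mem : ∀ x, m x ∈ Icc 0 M
  max : ∀ x, ∀ μ ∈ Icc 0 M, μ * (x - G μ) ≤ m x * (x - G (m x))

/-- A continuous increasing function `ψ` that vanishes on `(-∞, g]`, with a continuous strictly
increasing right inverse `S` on the positive reals. -/
structure IsSurplus (ψ : ℝ → ℝ) (g : ℝ) (S : ℝ → ℝ) : Prop where
  continuous : Continuous ψ
  monotone : Monotone ψ
  nonneg : ∀ x, 0 ≤ ψ x
  eq_zero : ∀ x ≤ g, ψ x = 0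
  inv_continuous : Continuous S
  inv_monotone : Monotone S
  inv_tendsto : Tendsto S atTop atTop
  apply_inv : ∀ y, 0 < y → ψ (S y) = y

theorem exists_isSurplusRate {G : ℝ → ℝ} {M : ℝ} (hM : 0 < M) (hc : ContinuousOn G (Icc 0 M)) :
    ∃ m, IsSurplusRate G M m := by
  have key : ∀ x, ∃ m ∈ Icc 0 M, ∀ μ ∈ Icc 0 M, μ * (x - G μ) ≤ m * (x - G m) := by
    intro x
    obtain ⟨m, hm, hmax⟩ := isCompact_Icc.exists_isMaxOn (nonempty_Icc.2 hM.le)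
      (f := fun μ => μ * (x - G μ)) (continuousOn_id.mul (continuousOn_const.sub hc))
    exact ⟨m, hm, fun μ hμ => hmax hμ⟩
  choose m hm hmax using key
  exact ⟨m, hm, hmax⟩

namespace IsSurplusRate

variable {G : ℝ → ℝ} {M : ℝ} {m : ℝ → ℝ}

/-- Revealed preference: adding the optimality of `m x` at `x` and of `m y` at `y` cancels all
values of `G`. -/
theorem monotone (h : IsSurplusRate G M m) : Monotone m := by
  intro x y hxy
  rcases hxy.eq_or_lt with rfl | hlt
  · exact le_rfl
  by_contra! hm
  nlinarith [h.max x _ (h.mem y), h.max y _ (h.mem x), mul_pos (sub_pos.2 hlt) (sub_pos.2 hm)]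

theorem surplus_nonneg (h : IsSurplusRate G M m) (x : ℝ) : 0 ≤ m x * (x - G (m x)) := by
  have := h.max x 0 ⟨le_rfl, (h.mem x).1.trans (h.mem x).2⟩
  simpa using this

theorem rate_eq_zero (h : IsSurplusRate G M m) (hG : StrictMonoOn G (Icc 0 M)) {x : ℝ}
    (hx : x ≤ G 0) : m x = 0 := by
  by_contra hne
  have hpos : 0 < m x := lt_of_le_of_ne (h.mem x).1 (Ne.symm hne)
  have h0 : G 0 < G (m x) := hG ⟨le_rfl, hpos.le.trans (h.mem x).2⟩ (h.mem x) hpos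
  nlinarith [h.surplus_nonneg x]

theorem rate_pos (h : IsSurplusRate G M m) {x : ℝ} (hx : 0 < m x * (x - G (m x))) : 0 < m x := by
  refine lt_of_le_of_ne (h.mem x).1 fun h0 => ?_
  rw [← h0] at hx
  simp at hx

theorem surplus_pos (h : IsSurplusRate G M m) (hM : 0 < M) (hc : ContinuousOn G (Icc 0 M))
    {x : ℝ} (hx : G 0 < x) : 0 < m x * (x - G (m x)) := by
  have h1 : ∀ᶠ μ in 𝓝[>] 0, G μ < x :=
    ((hc 0 ⟨le_rfl, hM.le⟩).mono_of_mem_nhdsWithin (Icc_mem_nhdsGT hM)).eventually_lt_const hx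
  obtain ⟨μ, hμx, hμ⟩ := (h1.and (Ioo_mem_nhdsGT hM)).exists
  exact (mul_pos hμ.1 (sub_pos.2 hμx)).trans_le (h.max x μ ⟨hμ.1.le, hμ.2.le⟩)

/-- The rate `m x` is a subgradient at `x`, the surplus being a supremum of affine functions. -/
theorem surplus_add_le (h : IsSurplusRate G M m) (x y : ℝ) :
    m x * (x - G (m x)) + m x * (y - x) ≤ m y * (y - G (m y)) := by
  linarith [h.max y _ (h.mem x)]

theorem surplus_monotone (h : IsSurplusRate G M m) : Monotone fun x => m x * (x - G (m x)) := by
  intro x y hxy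
  have := h.surplus_add_le x y
  have := mul_nonneg (h.mem x).1 (sub_nonneg.2 hxy)
  show m x * (x - G (m x)) ≤ m y * (y - G (m y))
  linarith

theorem surplus_continuous (h : IsSurplusRate G M m) :
    Continuous fun x => m x * (x - G (m x)) := by
  have hM : 0 ≤ M := (h.mem 0).1.trans (h.mem 0).2
  refine (LipschitzWith.of_le_add_mul ⟨M, hM⟩ fun x y => ?_).continuous
  have h1 := h.surplus_add_le x y
  have h2 : m x * (x - y) ≤ M * |x - y| :=
    (mul_le_mul_of_nonneg_left (le_abs_self _) (h.mem x).1).trans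
      (mul_le_mul_of_nonneg_right (h.mem x).2 (abs_nonneg _))
  rw [Real.dist_eq]
  show _ ≤ _ + M * |x - y|
  linarith

theorem exists_isSurplus (h : IsSurplusRate G M m) (hM : 0 < M) (hG : StrictMonoOn G (Icc 0 M))
    (hc : ContinuousOn G (Icc 0 M)) :
    ∃ S, IsSurplus (fun x => m x * (x - G (m x))) (G 0) S := by
  set ψ : ℝ → ℝ := fun x => m x * (x - G (m x)) with hψ
  have hzero : ∀ x ≤ G 0, ψ x = 0 := fun x hx => by simp [hψ, h.rate_eq_zero hG hx]
  -- The surplus is not injective on `(-∞, G 0]`, where it vanishes. The added term makes it a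
  -- bijection of the line without changing it on `[G 0, ∞)`; the inverse of `T` is the required
  -- `S`.
  let T : ℝ → ℝ := fun x => ψ x + min 0 (x - G 0)
  have hTc : Continuous T := h.surplus_continuous.add (by fun_prop)
  have hTm : StrictMono T := by
    intro x y hxy
    have h1 : ψ x ≤ ψ y := h.surplus_monotone hxy.le
    have h2 : min 0 (x - G 0) ≤ min 0 (y - G 0) := min_le_min le_rfl (by linarith)
    show ψ x + min 0 (x - G 0) < ψ y + min 0 (y - G 0)
    rcases lt_or_ge x (G 0) with hx | hx
    · have h3 : min 0 (x - G 0) < min 0 (y - G 0) := by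
        rw [min_eq_right (by linarith : x - G 0 ≤ 0)]
        exact lt_min (by linarith) (by linarith)
      linarith
    · rcases (h.surplus_nonneg x).eq_or_lt with h0 | h0
      · have h3 : ψ x = 0 := h0.symm
        have h4 : 0 < ψ y := h.surplus_pos hM hc (hx.trans_lt hxy)
        linarith
      · have h3 := h.surplus_add_le x y
        have h4 := mul_pos (h.rate_pos h0) (sub_pos.2 hxy)
        have h5 : ψ x < ψ y := by simp only [hψ]; linarith
        linarith
  have hTtop : Tendsto T atTop atTop := by
    have h1 : Tendsto (fun x => M * (x - G M)) atTop atTop :=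
      (tendsto_atTop_add_const_right _ _ tendsto_id).const_mul_atTop hM
    refine tendsto_atTop_mono' _ ?_ h1
    filter_upwards [eventually_ge_atTop (G 0)] with x hx
    have := h.max x M ⟨hM.le, le_rfl⟩
    simpa [T, min_eq_left (sub_nonneg.2 hx)] using this
  have hTbot : Tendsto T atBot atBot := by
    have h1 : Tendsto (fun x => x - G 0) atBot atBot :=
      tendsto_atBot_add_const_right _ _ tendsto_id
    refine tendsto_atBot_mono' _ ?_ h1
    filter_upwards [eventually_le_atBot (G 0)] with x hx
    simp [T, hzero x hx]
  let e := hTm.orderIsoOfSurjective T (hTc.surjective hTtop hTbot)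
  refine ⟨e.symm, h.surplus_continuous, h.surplus_monotone, h.surplus_nonneg, hzero,
    e.symm.continuous, e.symm.monotone, e.symm.tendsto_atTop, fun y hy => ?_⟩
  have h1 : T (e.symm y) = y := e.apply_symm_apply y
  have h2 : G 0 ≤ e.symm y := by
    by_contra! hlt
    have : T (e.symm y) < 0 := by
      simp only [T, hzero _ hlt.le, zero_add]
      exact (min_le_right _ _).trans_lt (by linarith)
    linarith
  simpa [T, min_eq_left (sub_nonneg.2 h2)] using h1

end IsSurplusRate

/-! ### The Bellman equation as a recursion for the increments. -/

/-- The solution at `q` of `d q = S (γ + s * q - φ (d (q + 1)))`, started `n` places above `q`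
with `φ = 0`. -/
noncomputable def backwardSolution (S φ : ℝ → ℝ) (s γ : ℝ) : ℕ → ℕ → ℝ
  | 0, q => S (γ + s * q)
  | n + 1, q => S (γ + s * q - φ (backwardSolution S φ s γ n (q + 1)))

/-- From some `K` on, uniformly in `γ ≥ 0`, the solution is so large that `φ` vanishes along it. The
recursion started at `K` is therefore exact, and each value is a finite composition, hence
continuous in `γ`. -/
theorem exists_halfline_solution {S φ : ℝ → ℝ} (hS : Continuous S) (hSm : Monotone S)
    (hSt : Tendsto S atTop atTop) (hφ : Continuous φ) (hφa : Antitone φ) {f : ℝ}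
    (hφ0 : ∀ d, f ≤ d → φ d = 0) {s : ℝ} (hs : 0 < s) (b : ℝ) :
    ∃ D : ℝ → ℕ → ℝ, (∀ q, Continuous fun γ => D γ q) ∧ (∀ q, Monotone fun γ => D γ q) ∧
      (∀ γ, 0 ≤ γ → ∀ q : ℕ, D γ q = S (γ + s * q - φ (D γ (q + 1)))) ∧
      (∀ γ, 0 ≤ γ → Monotone (D γ)) ∧ ∃ K : ℕ, ∀ γ, 0 ≤ γ → ∀ q, K ≤ q → b ≤ D γ q := by
  obtain ⟨K, hK⟩ : ∃ K : ℕ, ∀ q : ℕ, K ≤ q → max b f ≤ S (s * q) :=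
    eventually_atTop.1 ((hSt.comp
      (tendsto_natCast_atTop_atTop.const_mul_atTop hs)).eventually_ge_atTop (max b f))
  have hcont : ∀ n q, Continuous fun γ => backwardSolution S φ s γ n q := by
    intro n
    induction n with
    | zero => intro q; simp only [backwardSolution]; fun_prop
    | succ n ih =>
      intro q
      have := ih (q + 1)
      simp only [backwardSolution]
      fun_prop
  have hmono : ∀ n q, Monotone fun γ => backwardSolution S φ s γ n q := by
    intro n
    induction n with
    | zero =>
      intro q γ γ' hγ
      simp only [backwardSolution]
      exact hSm (by linarith)
    | succ n ih =>
      intro q γ γ' hγ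
      have := hφa (ih (q + 1) hγ)
      simp only [backwardSolution]
      exact hSm (by linarith)
  -- For `q ≥ K` the truncated difference `K - q` is `0`, so the value is `S (γ + s * q)`.
  have htail : ∀ γ, 0 ≤ γ → ∀ q, K ≤ q → max b f ≤ backwardSolution S φ s γ (K - q) q := by
    intro γ hγ q hq
    rw [Nat.sub_eq_zero_of_le hq, backwardSolution]
    exact (hK q hq).trans (hSm (by linarith))
  have hrec : ∀ γ, 0 ≤ γ → ∀ q : ℕ, backwardSolution S φ s γ (K - q) q =
      S (γ + s * q - φ (backwardSolution S φ s γ (K - (q + 1)) (q + 1))) := by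
    intro γ hγ q
    rcases lt_or_ge q K with hq | hq
    · conv_lhs => rw [show K - q = (K - (q + 1)) + 1 by omega, backwardSolution]
    · rw [hφ0 _ ((le_max_right _ _).trans (htail γ hγ (q + 1) (by omega))),
        Nat.sub_eq_zero_of_le hq, backwardSolution, sub_zero]
  refine ⟨fun γ q => backwardSolution S φ s γ (K - q) q, fun q => hcont _ q, fun q => hmono _ q,
    hrec, fun γ hγ => monotone_nat_of_le_succ fun q => ?_, K,
    fun γ hγ q hq => (le_max_left _ _).trans (htail γ hγ q hq)⟩
  beta_reduce
  obtain ⟨n, hn⟩ : ∃ n, K - q = n := ⟨_, rfl⟩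
  induction n generalizing q with
  | zero =>
    rw [Nat.sub_eq_zero_of_le (by omega : K ≤ q), Nat.sub_eq_zero_of_le (by omega : K ≤ q + 1)]
    simp only [backwardSolution]
    apply hSm
    push_cast
    linarith
  | succ n ih =>
    have h1 := hφa (ih (q + 1) (by omega))
    refine (hrec γ hγ q).trans_le (le_trans (hSm ?_) (hrec γ hγ (q + 1)).ge)
    push_cast
    linarith

theorem exists_monotone_increments {ψ₁ ψ₂ S₁ S₂ : ℝ → ℝ} {g₁ g₂ : ℝ} (h₁ : IsSurplus ψ₁ g₁ S₁)
    (h₂ : IsSurplus ψ₂ g₂ S₂) {s : ℝ} (hs : 0 < s) (b : ℝ) :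
    ∃ (γ : ℝ) (d : ℤ → ℝ), Monotone d ∧ (∀ q, ψ₂ (-d (q + 1)) + ψ₁ (d q) = γ + s * |(q : ℝ)|) ∧
      ∃ K : ℕ, (∀ q : ℤ, K ≤ q → b ≤ d q) ∧ ∀ q : ℤ, q ≤ -K → d q ≤ -b := by
  obtain ⟨D, hDc, hDγ, hD, hDm, K, hK⟩ := exists_halfline_solution h₁.inv_continuous
    h₁.inv_monotone h₁.inv_tendsto (h₂.continuous.comp continuous_neg)
    (h₂.monotone.comp_antitone fun _ _ => neg_le_neg) (f := -g₂)
    (fun d hd => h₂.eq_zero _ (by linarith)) hs b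
  -- The left half-line is the mirror image, with the two sides of the market exchanged: `E q`
  -- stands for `-d (1 - q)`.
  obtain ⟨E, hEc, hEγ, hE, hEm, L, hL⟩ := exists_halfline_solution h₂.inv_continuous
    h₂.inv_monotone h₂.inv_tendsto (h₁.continuous.comp continuous_neg)
    (h₁.monotone.comp_antitone fun _ _ => neg_le_neg) (f := -g₁)
    (fun d hd => h₁.eq_zero _ (by linarith)) hs b
  simp only [Function.comp_apply] at hD hE
  let f : ℝ → ℝ := fun γ => ψ₂ (-D γ 1) + ψ₁ (-E γ 1)
  have hf : ∀ γ, 0 ≤ f γ := fun γ => add_nonneg (h₂.nonneg _) (h₁.nonneg _)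
  have hfc : Continuous f :=
    (h₂.continuous.comp (hDc 1).neg).add (h₁.continuous.comp (hEc 1).neg)
  -- `f` is decreasing on account of the monotonicity of `D` and `E` in `γ`; so `γ - f γ` changes
  -- sign on `[0, f 0]`.
  have hfa : f (f 0) ≤ f 0 :=
    add_le_add (h₂.monotone (neg_le_neg (hDγ 1 (hf 0)))) (h₁.monotone (neg_le_neg (hEγ 1 (hf 0))))
  obtain ⟨γ, ⟨hγ, -⟩, hfγ⟩ := intermediate_value_Icc (hf 0)
    (f := fun γ => γ - f γ) (continuous_id.sub hfc).continuousOn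
    (⟨by linarith [hf 0], by linarith⟩ : (0 : ℝ) ∈ Icc (0 - f 0) (f 0 - f (f 0)))
  have hmatch : ψ₂ (-D γ 1) + ψ₁ (-E γ 1) = γ := by simp only [f] at hfγ; linarith
  -- `S₁` inverts `ψ₁` at positive arguments only. Matching at `0` gives `ψ₂ (-D γ 1) ≤ γ`, which
  -- makes the argument positive.
  have hDrec : ∀ q : ℕ, 1 ≤ q → ψ₂ (-D γ (q + 1)) + ψ₁ (D γ q) = γ + s * q := by
    intro q hq
    have h3 : ψ₂ (-D γ (q + 1)) ≤ ψ₂ (-D γ 1) :=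
      h₂.monotone (neg_le_neg (hDm γ hγ (by omega)))
    have h4 : 0 < s * (q : ℝ) := mul_pos hs (by exact_mod_cast hq)
    rw [hD γ hγ q, h₁.apply_inv _ (by linarith [h₁.nonneg (-E γ 1)])]
    ring
  have hErec : ∀ q : ℕ, 1 ≤ q → ψ₂ (E γ q) + ψ₁ (-E γ (q + 1)) = γ + s * q := by
    intro q hq
    have h3 : ψ₁ (-E γ (q + 1)) ≤ ψ₁ (-E γ 1) :=
      h₁.monotone (neg_le_neg (hEm γ hγ (by omega)))
    have h4 : 0 < s * (q : ℝ) := mul_pos hs (by exact_mod_cast hq)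
    rw [hE γ hγ q, h₂.apply_inv _ (by linarith [h₂.nonneg (-D γ 1)])]
    ring
  -- Otherwise the left side of the equation at `q = 1` would be at most the one at `q = 0`, yet it
  -- exceeds it by `s`.
  have hcross : -E γ 1 ≤ D γ 1 := by
    by_contra! hlt
    have h3 := h₁.monotone hlt.le
    have h4 := hDrec 1 le_rfl
    have h5 : ψ₂ (-D γ (1 + 1)) ≤ ψ₂ (-D γ 1) :=
      h₂.monotone (neg_le_neg (hDm γ hγ (by omega)))
    simp at h4
    linarith
  let d : ℤ → ℝ := fun q => if 1 ≤ q then D γ q.toNat else -E γ (1 - q).toNat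
  have hd_pos : ∀ q : ℤ, 1 ≤ q → d q = D γ q.toNat := fun q hq => if_pos hq
  have hd_neg : ∀ q : ℤ, q ≤ 0 → d q = -E γ (1 - q).toNat := fun q hq => if_neg (by omega)
  refine ⟨γ, d, monotone_int_of_le_succ fun q => ?_, fun q => ?_, max K L + 1,
    fun q hq => ?_, fun q hq => ?_⟩
  · rcases lt_trichotomy q 0 with hq | rfl | hq
    · rw [hd_neg q hq.le, hd_neg (q + 1) (by omega)]
      exact neg_le_neg (hEm γ hγ (by omega))
    · rw [hd_neg 0 le_rfl, hd_pos (0 + 1) (by omega)]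
      simpa using hcross
    · rw [hd_pos q hq, hd_pos (q + 1) (by omega)]
      exact hDm γ hγ (by omega)
  · rcases lt_trichotomy q 0 with hq | rfl | hq
    · obtain ⟨n, rfl⟩ : ∃ n : ℕ, q = -(n : ℤ) := ⟨q.natAbs, by omega⟩
      rw [hd_neg _ hq.le, hd_neg _ (by omega)]
      have := hErec n (by omega)
      rw [show (1 - (-(n : ℤ) + 1)).toNat = n by omega,
        show (1 - -(n : ℤ)).toNat = n + 1 by omega]
      simpa using this
    · rw [hd_neg 0 le_rfl, hd_pos (0 + 1) (by omega)]
      simpa using hmatch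
    · obtain ⟨n, rfl⟩ : ∃ n : ℕ, q = n := ⟨q.toNat, by omega⟩
      rw [hd_pos _ hq, hd_pos _ (by omega)]
      have := hDrec n (by omega)
      rw [show ((n : ℤ) + 1).toNat = n + 1 by omega, show (n : ℤ).toNat = n by omega]
      simpa using this
  · push_cast at hq
    have := le_max_left (K : ℤ) L
    rw [hd_pos q (by omega)]
    exact hK γ hγ _ (by omega)
  · push_cast at hq
    have := le_max_right (K : ℤ) L
    rw [hd_neg q (by omega)]
    exact neg_le_neg (hL γ hγ _ (by omega))

/-! ### Functions on the integers with prescribed increments. -/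

theorem exists_int_antideriv (f : ℤ → ℝ) :
    ∃ h : ℤ → ℝ, h 0 = 0 ∧ ∀ q, h q = h (q + 1) + f (q + 1) := by
  refine ⟨fun q => ∑ i ∈ Finset.range (-q).toNat, f (-i) - ∑ i ∈ Finset.range q.toNat, f (i + 1),
    by simp, fun q => ?_⟩
  beta_reduce
  rcases lt_or_ge q 0 with hq | hq
  · rw [show q.toNat = 0 by omega, show (q + 1).toNat = 0 by omega,
      show (-q).toNat = (-(q + 1)).toNat + 1 by omega, Finset.sum_range_succ,
      show (-(((-(q + 1)).toNat : ℕ) : ℤ)) = q + 1 by omega]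
    ring
  · rw [show (-q).toNat = 0 by omega, show (-(q + 1)).toNat = 0 by omega,
      show (q + 1).toNat = q.toNat + 1 by omega, Finset.sum_range_succ,
      show ((q.toNat : ℕ) : ℤ) = q by omega]
    ring

theorem abs_le_mul_abs_of_increments {w f : ℤ → ℝ} {B : ℝ} (h0 : w 0 = 0)
    (hw : ∀ q, w q = w (q + 1) + f (q + 1)) (hf : ∀ q, |f q| ≤ B) (q : ℤ) :
    |w q| ≤ B * |(q : ℝ)| := by
  induction q using Int.induction_on with
  | zero => simp [h0]
  | succ n ih =>
    have h1 := hw n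
    have h2 := abs_sub (w n) (f (n + 1))
    rw [show w (n + 1) = w n - f (n + 1) by linarith]
    have h3 := hf (n + 1)
    push_cast at ih ⊢
    rw [abs_of_nonneg (by positivity : (0 : ℝ) ≤ n)] at ih
    rw [abs_of_nonneg (by positivity : (0 : ℝ) ≤ n + 1)]
    linarith
  | pred n ih =>
    have h1 := hw (-n - 1)
    rw [sub_add_cancel] at h1
    have h2 := abs_add_le (w (-n)) (f (-n))
    have h3 := hf (-n)
    push_cast at ih ⊢
    have hn : (0 : ℝ) ≤ n := n.cast_nonneg
    rw [abs_of_nonpos (by linarith : -(n : ℝ) ≤ 0)] at ih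
    rw [abs_of_nonpos (by linarith : -(n : ℝ) - 1 ≤ 0), h1]
    linarith

theorem bddAbove_of_increments {h d : ℤ → ℝ} (hh : ∀ q, h q = h (q + 1) + d (q + 1)) {K : ℕ}
    (hpos : ∀ q : ℤ, K ≤ q → 0 ≤ d q) (hneg : ∀ q : ℤ, q ≤ -K → d q ≤ 0) :
    ∃ H, ∀ q, h q ≤ H := by
  have hup : ∀ n : ℕ, h (K + n) ≤ h K := by
    intro n
    induction n with
    | zero => simp
    | succ n ih =>
      have h1 := hh (K + n)
      have h2 := hpos (K + n + 1) (by omega)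
      push_cast
      rw [← add_assoc]
      linarith
  have hdown : ∀ n : ℕ, h (-K - n) ≤ h (-K) := by
    intro n
    induction n with
    | zero => simp
    | succ n ih =>
      have h1 := hh (-K - n - 1)
      rw [sub_add_cancel] at h1
      have h2 := hneg (-K - n) (by omega)
      push_cast
      rw [← sub_sub]
      linarith
  have hle : ∀ q ∈ Finset.Icc (-K : ℤ) K, h q ≤ ∑ i ∈ Finset.Icc (-K : ℤ) K, |h i| := fun q hq =>
    (le_abs_self _).trans (Finset.single_le_sum (f := fun i => |h i|)
      (fun i _ => abs_nonneg _) hq)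
  refine ⟨∑ i ∈ Finset.Icc (-K : ℤ) K, |h i|, fun q => ?_⟩
  by_cases hq : q ∈ Finset.Icc (-K : ℤ) K
  · exact hle q hq
  · rw [Finset.mem_Icc, not_and_or, not_le, not_le] at hq
    rcases hq with hq | hq
    · have := hdown (-K - q).toNat
      rw [show -(K : ℤ) - ((-K - q).toNat : ℕ) = q by omega] at this
      exact this.trans (hle _ (by simp))
    · have := hup (q - K).toNat
      rw [show (K : ℤ) + ((q - K).toNat : ℕ) = q by omega] at this
      exact this.trans (hle _ (by simp))

/-! ### Long-run averages. -/

/-- Here `S` is the cumulative profit and `a` the expected total queue length. Averages staying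
above `γ` would force `a` to be large by `h₁`, and the holding costs in `h₂` would then bring the
average back down to `γ`. -/
theorem liminf_average_le {S a : ℕ → ℝ} {γ C B P s : ℝ} (hs : 0 < s) (hB : 0 ≤ B)
    (ha : ∀ n, 0 ≤ a n) (h₁ : ∀ N : ℕ, S N ≤ N * γ + C + B * a N)
    (h₂ : ∀ N : ℕ, S N ≤ N * P - s * ∑ k ∈ Finset.range N, a k) :
    liminf (fun N : ℕ => ((S N / (N : ℝ) : ℝ) : EReal)) atTop ≤ γ := by
  by_contra! hlt
  obtain ⟨r, hγr, hr⟩ := EReal.lt_iff_exists_real_btwn.1 hlt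
  have hγr : γ < r := by exact_mod_cast hγr
  have hS : ∀ᶠ N : ℕ in atTop, N * r < S N := by
    filter_upwards [eventually_lt_of_lt_liminf hr, eventually_gt_atTop 0] with N hN h0
    have hN : r < S N / N := by exact_mod_cast hN
    rw [lt_div_iff₀ (by exact_mod_cast h0)] at hN
    linarith
  have hlarge : ∀ c : ℝ, ∀ᶠ N : ℕ in atTop, c < (r - γ) * N := fun c =>
    (tendsto_natCast_atTop_atTop.const_mul_atTop (sub_pos.2 hγr)).eventually_gt_atTop c
  -- At queue length `A` the holding cost uses up the whole excess of the profit bound `P` over `γ`.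
  let A := (P - γ) / s
  have hA : s * A = P - γ := mul_div_cancel₀ _ hs.ne'
  have haA : ∀ᶠ N : ℕ in atTop, A ≤ a N := by
    filter_upwards [hS, hlarge (C + B * A)] with N h3 h4
    by_contra! h5
    linarith [h₁ N, mul_le_mul_of_nonneg_left h5.le hB]
  obtain ⟨n, hn⟩ := eventually_atTop.1 haA
  have hsum : ∀ N, n ≤ N → A * (N - n) ≤ ∑ k ∈ Finset.range N, a k := by
    intro N hN
    induction N, hN using Nat.le_induction with
    | base => simpa using Finset.sum_nonneg fun k _ => ha k
    | succ N hN ih =>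
      rw [Finset.sum_range_succ]
      push_cast
      linarith [hn N hN]
  obtain ⟨N, h3, h4, h5⟩ :=
    (hS.and ((hlarge (s * A * n)).and (eventually_ge_atTop n))).exists
  have h6 := mul_le_mul_of_nonneg_left (hsum N h5) hs.le
  have h7 : s * (A * ((N : ℝ) - n)) = (P - γ) * N - s * A * n := by rw [← hA]; ring
  linarith [h₂ N]

theorem le_liminf_average {S : ℕ → ℝ} {γ C : ℝ} (h : ∀ N : ℕ, N * γ + C ≤ S N) :
    (γ : EReal) ≤ liminf (fun N : ℕ => ((S N / (N : ℝ) : ℝ) : EReal)) atTop := by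
  have h1 : Tendsto (fun N : ℕ => ((γ + C / N : ℝ) : EReal)) atTop (𝓝 (γ : EReal)) := by
    refine (continuous_coe_real_ereal.tendsto γ).comp ?_
    simpa using (tendsto_const_div_atTop_nhds_zero_nat C).const_add γ
  rw [← h1.liminf_eq]
  refine liminf_le_liminf ?_
  filter_upwards [eventually_gt_atTop 0] with N hN
  have hN : (0 : ℝ) < N := by exact_mod_cast hN
  rw [EReal.coe_le_coe_iff, le_div_iff₀ hN, add_mul, div_mul_cancel₀ _ hN.ne']
  linarith [h N]

/-! ### Verification bounds for the controlled chain. -/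

namespace SingleLinkQueue

theorem unif_pos (Q : SingleLinkQueue) : 0 < Q.unif := by
  linarith [Q.lamMax_pos, Q.muMax_pos, Q.unif_ge]

/-- The number of waiting customers minus the number of waiting servers. -/
def imbalance (x : State) : ℤ := (x.2 : ℤ) - x.1

theorem abs_imbalance_le (x : State) : |(imbalance x : ℝ)| ≤ (x.1 : ℝ) + x.2 := by
  have : |imbalance x| ≤ (x.1 : ℤ) + x.2 := by
    rw [imbalance, abs_le]
    omega
  exact_mod_cast this

theorem abs_imbalance_eq {x : State} (hx : x.1 = 0 ∨ x.2 = 0) :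
    |(imbalance x : ℝ)| = (x.1 : ℝ) + x.2 := by
  have : |imbalance x| = (x.1 : ℤ) + x.2 := by
    rcases hx with hx | hx <;> simp [imbalance, hx]
  exact_mod_cast this

namespace Policy

variable {Q : SingleLinkQueue} (π : Policy Q)

/-- The policy `π` keeps the system in `A`. -/
def Preserves (A : Set State) : Prop :=
  ∀ x ∈ A, π.settle (x.1, x.2 + 1) ∈ A ∧ π.settle (x.1 + 1, x.2) ∈ A

theorem preserves_univ : π.Preserves univ := fun _ _ => ⟨mem_univ _, mem_univ _⟩

theorem imbalance_settle (x : State) : imbalance (π.settle x) = imbalance x := by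
  have := π.matched_le x
  simp only [imbalance, settle]
  omega

theorem stay_nonneg (x : State) : 0 ≤ 1 - (π.lam x + π.mu x) / Q.unif := by
  rw [sub_nonneg, div_le_one Q.unif_pos]
  linarith [(π.lam_mem x).2, (π.mu_mem x).2, Q.unif_ge]

variable {π} in
theorem step_mono {A : Set State} (hA : π.Preserves A) {f g : State → ℝ}
    (hfg : ∀ x ∈ A, f x ≤ g x) : ∀ x ∈ A, π.step f x ≤ π.step g x := fun x hx =>
  add_le_add (add_le_add
    (mul_le_mul_of_nonneg_left (hfg _ (hA x hx).1) (div_nonneg (π.lam_mem x).1 Q.unif_pos.le))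
    (mul_le_mul_of_nonneg_left (hfg _ (hA x hx).2) (div_nonneg (π.mu_mem x).1 Q.unif_pos.le)))
    (mul_le_mul_of_nonneg_left (hfg _ hx) (π.stay_nonneg x))

variable {π} in
theorem expect_mono {A : Set State} (hA : π.Preserves A) {f g : State → ℝ}
    (hfg : ∀ x ∈ A, f x ≤ g x) (k : ℕ) : ∀ x ∈ A, π.expect k f x ≤ π.expect k g x := by
  induction k generalizing f g with
  | zero => exact hfg
  | succ k ih => exact ih (step_mono hA hfg)

theorem step_combination (a b : ℝ) (f g : State → ℝ) :
    π.step (fun x => a + b * f x + g x) = fun x => a + b * π.step f x + π.step g x := by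
  funext x
  simp only [step]
  ring

theorem expect_combination (a b : ℝ) (f g : State → ℝ) (k : ℕ) (x : State) :
    π.expect k (fun x => a + b * f x + g x) x = a + b * π.expect k f x + π.expect k g x := by
  induction k generalizing f g with
  | zero => rfl
  | succ k ih =>
    show π.expect k (π.step _) x = _
    rw [step_combination, ih]
    rfl

theorem expect_affine (a b : ℝ) (f : State → ℝ) (k : ℕ) (x : State) :
    π.expect k (fun x => a + b * f x) x = a + b * π.expect k f x := by
  have h := π.expect_combination a (b - 1) f f k x
  rw [show (fun x => a + (b - 1) * f x + f x) = fun x => a + b * f x by funext y; ring] at h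
  rw [h]
  ring

/-- Profits are compared with `γ + c * (u - π.step u)`, whose expected sum leaves only boundary
terms. -/
theorem sum_expect_telescope (γ c : ℝ) (u : State → ℝ) (N : ℕ) (x : State) :
    ∑ k ∈ Finset.range N, π.expect k (fun y => γ + c * (u y - π.step u y)) x =
      N * γ + c * (u x - π.expect N u x) := by
  have h : ∀ k, π.expect k (fun y => γ + c * (u y - π.step u y)) x =
      γ + c * π.expect k u x - c * π.expect (k + 1) u x := by
    intro k
    have h1 := π.expect_combination γ c u (fun y => 0 + -c * π.step u y) k x
    rw [expect_affine] at h1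
    rw [show (fun y => γ + c * (u y - π.step u y)) =
      fun y => γ + c * u y + (0 + -c * π.step u y) by funext y; ring, h1]
    show _ = γ + c * π.expect k u x - c * π.expect k (π.step u) x
    ring
  induction N with
  | zero => simp [expect]
  | succ N ih =>
    rw [Finset.sum_range_succ, ih, h]
    push_cast
    ring

/-- Matching leaves the imbalance unchanged, so the drift does not depend on the matching rule. This
lets one function of the imbalance treat all joint policies. -/
theorem unif_mul_sub_step (w : ℤ → ℝ) (x : State) :
    Q.unif * (w (imbalance x) - π.step (fun y => w (imbalance y)) x) =
      -(π.lam x * (w (imbalance x + 1) - w (imbalance x))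
        + π.mu x * (w (imbalance x - 1) - w (imbalance x))) := by
  have h1 : imbalance (x.1, x.2 + 1) = imbalance x + 1 := by simp [imbalance]; ring
  have h2 : imbalance (x.1 + 1, x.2) = imbalance x - 1 := by simp [imbalance]; ring
  have hc := Q.unif_pos.ne'
  simp only [step, imbalance_settle, h1, h2]
  field_simp
  ring

/-- A supersolution of linear growth of the optimality equation bounds the average profit. -/
theorem averageProfit_le {γ B : ℝ} {w : ℤ → ℝ} (hB : ∀ q, |w q| ≤ B * |(q : ℝ)|)
    (hw : ∀ q : ℤ, ∀ lam ∈ Icc 0 Q.lamMax, ∀ mu ∈ Icc 0 Q.muMax,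
      lam * Q.demand lam - mu * Q.supply mu + lam * (w (q + 1) - w q) + mu * (w (q - 1) - w q)
        ≤ γ + Q.holding * |(q : ℝ)|) {P : ℝ}
    (hP : ∀ lam ∈ Icc 0 Q.lamMax, ∀ mu ∈ Icc 0 Q.muMax,
      lam * Q.demand lam - mu * Q.supply mu ≤ P) (x : State) :
    π.averageProfit x ≤ γ := by
  let u : State → ℝ := fun y => w (imbalance y)
  let L : State → ℝ := fun y => (y.1 : ℝ) + y.2
  have hB0 : 0 ≤ B := by simpa using (abs_nonneg _).trans (hB 1)
  have hL : ∀ k, 0 ≤ π.expect k L x := by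
    intro k
    have h := expect_mono π.preserves_univ (f := fun _ => 0 + 0 * 0) (g := L)
      (fun y _ => by simpa [L] using add_nonneg (Nat.cast_nonneg _) (Nat.cast_nonneg _))
      k x (mem_univ _)
    rw [π.expect_affine 0 0 (fun _ => 0)] at h
    simpa using h
  refine liminf_average_le (a := fun k => π.expect k L x) (C := Q.unif * u x)
    (B := Q.unif * B) (P := P) Q.holding_pos (mul_nonneg Q.unif_pos.le hB0) hL
    (fun N => ?_) (fun N => ?_)
  · have h1 : ∑ k ∈ Finset.range N, π.expect k π.profit x ≤
        N * γ + Q.unif * (u x - π.expect N u x) := by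
      rw [← sum_expect_telescope]
      refine Finset.sum_le_sum fun k _ => expect_mono π.preserves_univ (fun y _ => ?_) k x
        (mem_univ _)
      have h2 := hw (imbalance y) _ (π.lam_mem y) _ (π.mu_mem y)
      have h3 := mul_le_mul_of_nonneg_left (abs_imbalance_le y) Q.holding_pos.le
      have h4 := π.unif_mul_sub_step w y
      simp only [profit, u]
      linarith
    have h5 : 0 + -B * π.expect N L x ≤ π.expect N u x := by
      rw [← expect_affine]
      refine expect_mono π.preserves_univ (fun y _ => ?_) N x (mem_univ _)
      have h6 := neg_le_of_abs_le (hB (imbalance y))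
      have h7 := mul_le_mul_of_nonneg_left (abs_imbalance_le y) hB0
      simp only [u, L]
      linarith
    have h8 := mul_le_mul_of_nonneg_left h5 Q.unif_pos.le
    linarith
  · have h1 : ∀ k, π.expect k π.profit x ≤ P + -Q.holding * π.expect k L x := by
      intro k
      rw [← expect_affine]
      refine expect_mono π.preserves_univ (fun y _ => ?_) k x (mem_univ _)
      have h2 := hP _ (π.lam_mem y) _ (π.mu_mem y)
      simp only [profit, L]
      linarith
    refine (Finset.sum_le_sum fun k _ => h1 k).trans_eq ?_
    rw [Finset.sum_add_distrib, ← Finset.mul_sum]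
    simp
    ring

variable {π}

/-- An upper bound on `h` suffices, since the boundary term `-π.expect N u x` need only be bounded
below. The restriction to `A` matters because the holding cost equals `s * |q|` only when one queue
is empty. -/
theorem le_averageProfit {A : Set State} (hA : π.Preserves A) {γ H : ℝ} {h : ℤ → ℝ}
    (hH : ∀ q, h q ≤ H)
    (hh : ∀ x ∈ A, γ ≤ π.profit x + π.lam x * (h (imbalance x + 1) - h (imbalance x))
      + π.mu x * (h (imbalance x - 1) - h (imbalance x))) {x : State} (hx : x ∈ A) :
    γ ≤ π.averageProfit x := by
  let u : State → ℝ := fun y => h (imbalance y)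
  refine le_liminf_average (C := Q.unif * (u x - H)) fun N => ?_
  have h1 : N * γ + Q.unif * (u x - π.expect N u x) ≤
      ∑ k ∈ Finset.range N, π.expect k π.profit x := by
    rw [← sum_expect_telescope]
    refine Finset.sum_le_sum fun k _ => expect_mono hA (fun y hy => ?_) k x hx
    have h2 := hh y hy
    have h4 := π.unif_mul_sub_step h y
    simp only [u]
    linarith
  have h5 : π.expect N u x ≤ H + 0 * π.expect N u x := by
    rw [← expect_affine]
    exact expect_mono hA (fun y _ => by simpa [u] using hH (imbalance y)) N x hx
  have h6 := mul_le_mul_of_nonneg_left h5 Q.unif_pos.le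
  linarith

/-! ### Stability. -/

theorem step_nonneg {f : State → ℝ} (hf : ∀ x, 0 ≤ f x) (x : State) : 0 ≤ π.step f x := by
  have h := step_mono π.preserves_univ (f := fun _ => 0) (fun y _ => hf y) x (mem_univ _)
  simpa [step] using h

theorem noReturn_nonneg (n : ℕ) (x : State) : 0 ≤ π.noReturn n x := by
  induction n generalizing x with
  | zero => exact zero_le_one
  | succ n ih =>
    refine step_nonneg (fun y => ?_) x
    split_ifs
    exacts [le_rfl, ih y]

theorem step_sum (s : Finset ℕ) (f : ℕ → State → ℝ) (x : State) :
    π.step (fun y => ∑ n ∈ s, f n y) x = ∑ n ∈ s, π.step (f n) x := by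
  simp only [step, Finset.mul_sum, Finset.sum_add_distrib]

/-- Foster's criterion. -/
theorem stable_of_lyapunov {A : Set State} (hA : π.Preserves A) (h0 : 0 ∈ A) {V : State → ℝ}
    (hV : ∀ x, 0 ≤ V x) (hdrift : ∀ x ∈ A, x ≠ 0 → 1 + π.step V x ≤ V x) : π.Stable := by
  -- The bound also covers `x = 0`, where no drift is assumed: the drift condition is applied only
  -- after one step, to states other than `0`.
  have key : ∀ N, ∀ x ∈ A, ∑ n ∈ Finset.range N, π.noReturn n x ≤ 1 + π.step V x := by
    intro N
    induction N with
    | zero =>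
      intro x _
      simpa using add_nonneg zero_le_one (step_nonneg hV x)
    | succ N ih =>
      intro x hx
      rw [Finset.sum_range_succ', add_comm]
      refine add_le_add le_rfl ?_
      simp only [noReturn]
      rw [← step_sum]
      refine step_mono hA (fun y hy => ?_) x hx
      by_cases hy0 : y = 0
      · simpa [hy0] using hV 0
      · simpa [hy0] using (ih y hy).trans (hdrift y hy hy0)
  exact summable_of_sum_range_le (noReturn_nonneg · 0) (key · 0 h0)

end Policy

theorem PricingPolicy.preserves_immediate {Q : SingleLinkQueue} (p : PricingPolicy Q) :
    p.withImmediateMatching.Preserves {x | x.1 = 0 ∨ x.2 = 0} := by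
  intro x _
  simp only [Policy.settle, withImmediateMatching, mem_ofPred_eq]
  omega

theorem PricingPolicy.stable_immediate {Q : SingleLinkQueue} (p : PricingPolicy Q) {m : ℝ}
    (hm : 0 < m) {K : ℕ} (hmu : ∀ q, 1 ≤ q → m ≤ p.mu q) (hlam : ∀ q, q ≤ -1 → m ≤ p.lam q)
    (hlam0 : ∀ q : ℤ, K ≤ q → p.lam q = 0) (hmu0 : ∀ q : ℤ, q ≤ -K → p.mu q = 0) :
    p.withImmediateMatching.Stable := by
  have hc := Q.unif_pos
  -- Increments of the Lyapunov function in `|q|`, solving `m * e i = c + c * e (i + 1)` for `i + 1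
  -- = K` with `e (i + 1)` replaced by `0` relaxed upwards: below `K` they satisfy `m * e i = m * e
  -- (i + 1) + c * e (i + 1)`, so an inward rate `m` outweighs any outward rate up to `c`. From `K`
  -- on the truncated exponent makes them constant.
  let e : ℕ → ℝ := fun i => Q.unif / m * (1 + Q.unif / m) ^ (K - i)
  have he0 : ∀ i, 0 ≤ e i := fun i => by positivity
  have he : ∀ i, Q.unif ≤ m * e i := by
    intro i
    have h1 : (1 : ℝ) ≤ (1 + Q.unif / m) ^ (K - i) :=
      one_le_pow₀ (by linarith [div_pos hc hm])
    have h2 : m * e i = Q.unif * (1 + Q.unif / m) ^ (K - i) := by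
      simp only [e]
      field_simp
    rw [h2]
    nlinarith
  have hdecr : ∀ i, ∀ a r : ℝ, m ≤ a → 0 ≤ r → r ≤ Q.unif → (K ≤ i + 1 → r = 0) →
      Q.unif ≤ a * e i - r * e (i + 1) := by
    intro i a r ha hr0 hr hrK
    have h1 := mul_le_mul_of_nonneg_right ha (he0 i)
    rcases le_or_gt K (i + 1) with hK | hK
    · rw [hrK hK]
      linarith [he i]
    · have h2 : m * e i = m * e (i + 1) + Q.unif * e (i + 1) := by
        simp only [e]
        rw [show K - i = K - (i + 1) + 1 by omega, pow_succ]
        field_simp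
      linarith [he (i + 1), mul_le_mul_of_nonneg_right hr (he0 (i + 1))]
  let v : ℤ → ℝ := fun q => ∑ i ∈ Finset.range q.natAbs, e i
  refine Policy.stable_of_lyapunov p.preserves_immediate (Or.inl rfl)
    (V := fun x => v (imbalance x)) (fun x => Finset.sum_nonneg fun i _ => he0 i) ?_
  intro x hx hx0
  have hne : imbalance x ≠ 0 := by
    intro h
    apply hx0
    have hx : x.1 = 0 ∨ x.2 = 0 := hx
    unfold imbalance at h
    exact Prod.ext (by simp; omega) (by simp; omega)
  have h1 := p.withImmediateMatching.unif_mul_sub_step v x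
  suffices h : Q.unif * 1 ≤ Q.unif * (v (imbalance x) -
      p.withImmediateMatching.step (fun y => v (imbalance y)) x) by
    have := le_of_mul_le_mul_left h hc
    linarith
  rw [h1]
  show _ ≤ -(p.lam (imbalance x) * _ + p.mu (imbalance x) * _)
  generalize imbalance x = q at hne
  have hl := p.lam_mem q
  have hu := p.mu_mem q
  have hsum := Q.unif_ge
  have hlp := Q.lamMax_pos
  have hup := Q.muMax_pos
  rcases lt_or_gt_of_ne hne with hq | hq
  · obtain ⟨n, rfl⟩ : ∃ n : ℕ, q = -((n : ℤ) + 1) := ⟨(-q - 1).toNat, by omega⟩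
    have h2 := hdecr n (p.lam (-((n : ℤ) + 1))) (p.mu (-((n : ℤ) + 1))) (hlam _ (by omega)) hu.1
      (by linarith [hu.2]) fun hK => hmu0 _ (by omega)
    simp only [v]
    rw [show (-((n : ℤ) + 1) + 1).natAbs = n by omega,
      show (-((n : ℤ) + 1)).natAbs = n + 1 by omega,
      show (-((n : ℤ) + 1) - 1).natAbs = n + 1 + 1 by omega, Finset.sum_range_succ _ (n + 1),
      Finset.sum_range_succ _ n]
    linarith
  · obtain ⟨n, rfl⟩ : ∃ n : ℕ, q = (n : ℤ) + 1 := ⟨(q - 1).toNat, by omega⟩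
    have h2 := hdecr n (p.mu ((n : ℤ) + 1)) (p.lam ((n : ℤ) + 1)) (hmu _ (by omega)) hl.1
      (by linarith [hl.2]) fun hK => hlam0 _ (by omega)
    simp only [v]
    rw [show ((n : ℤ) + 1 + 1).natAbs = n + 1 + 1 by omega,
      show ((n : ℤ) + 1).natAbs = n + 1 by omega,
      show ((n : ℤ) + 1 - 1).natAbs = n by omega, Finset.sum_range_succ _ (n + 1),
      Finset.sum_range_succ _ n]
    linarith

end SingleLinkQueue

/-! ### Assembly: the policy, its optimality and its monotone prices. -/

theorem mainTheorem4 (Q : SingleLinkQueue) :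
    ∃ p : SingleLinkQueue.PricingPolicy Q,
      p.withImmediateMatching.IsOptimal ∧
      (∃ (γ : ℝ) (h : ℤ → ℝ), p.SolvesBellman γ h ∧
        ∀ x : SingleLinkQueue.State, (x.1 = 0 ∨ x.2 = 0) →
          p.withImmediateMatching.averageProfit x = (γ : EReal)) ∧
      Monotone p.serverPrice ∧ Monotone p.customerPrice := by
  have hs := Q.holding_pos
  have hc := Q.unif_pos
  obtain ⟨m₁, hm₁⟩ := exists_isSurplusRate Q.muMax_pos Q.supply_continuous
  obtain ⟨m₂, hm₂⟩ := exists_isSurplusRate (G := fun l => -Q.demand l) Q.lamMax_pos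
    Q.demand_continuous.neg
  have hneg : StrictMonoOn (fun l => -Q.demand l) (Icc 0 Q.lamMax) := Q.demand_strictAnti.neg
  obtain ⟨S₁, hS₁⟩ := hm₁.exists_isSurplus Q.muMax_pos Q.supply_strictMono Q.supply_continuous
  obtain ⟨S₂, hS₂⟩ := hm₂.exists_isSurplus Q.lamMax_pos hneg Q.demand_continuous.neg
  set ψ₁ : ℝ → ℝ := fun x => m₁ x * (x - Q.supply (m₁ x)) with hψ₁
  set ψ₂ : ℝ → ℝ := fun x => m₂ x * (x - -Q.demand (m₂ x)) with hψ₂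
  -- The threshold serves three ends: beyond `K` the sign of `d` bounds `h` above, `d ≥ F 0` stops
  -- customer arrivals on the right, and `d ≤ G 0` stops server arrivals on the left.
  obtain ⟨γ, d, hd, hdeq, K, hK, hK'⟩ := exists_monotone_increments hS₁ hS₂ hs
    (max 0 (max (Q.demand 0) (-Q.supply 0)))
  obtain ⟨h, -, hh⟩ := exists_int_antideriv d
  have hh1 : ∀ q, h (q + 1) - h q = -d (q + 1) := fun q => by linarith [hh q]
  have hh2 : ∀ q, h (q - 1) - h q = d q := fun q => by
    have := hh (q - 1)
    rw [sub_add_cancel] at this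
    linarith
  have hmax : ∀ (a b : ℝ), ∀ lam ∈ Icc 0 Q.lamMax, ∀ mu ∈ Icc 0 Q.muMax,
      lam * Q.demand lam - mu * Q.supply mu + lam * -a + mu * b ≤ ψ₂ (-a) + ψ₁ b := by
    intro a b lam hlam mu hmu
    have h1 := hm₁.max b mu hmu
    have h2 := hm₂.max (-a) lam hlam
    simp only [hψ₁, hψ₂]
    linarith
  let p : SingleLinkQueue.PricingPolicy Q :=
    ⟨fun q => m₂ (-d (q + 1)), fun q => m₁ (d q), fun q => hm₂.mem _, fun q => hm₁.mem _⟩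
  have hp : ∀ q, p.lam q * Q.demand (p.lam q) - p.mu q * Q.supply (p.mu q)
      + p.lam q * (h (q + 1) - h q) + p.mu q * (h (q - 1) - h q) = γ + Q.holding * |(q : ℝ)| := by
    intro q
    rw [hh1, hh2, ← hdeq q]
    simp only [p, hψ₁, hψ₂]
    ring
  have hbell : ∀ q lam mu, SingleLinkQueue.bellmanValue Q γ h q lam mu = h q +
      (lam * Q.demand lam - mu * Q.supply mu + lam * (h (q + 1) - h q) + mu * (h (q - 1) - h q)
        - (γ + Q.holding * |(q : ℝ)|)) / Q.unif := by
    intro q lam mu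
    unfold SingleLinkQueue.bellmanValue
    field_simp
    ring
  -- the growth-controlled supersolution, with clipped increments
  let a := min (Q.demand 0) (Q.supply 0)
  let b := max (Q.demand 0) (Q.supply 0)
  have hab : a ≤ b := min_le_max
  let e : ℤ → ℝ := fun q => max a (min (d q) b)
  obtain ⟨w, hw0, hw⟩ := exists_int_antideriv e
  have hw1 : ∀ q, w (q + 1) - w q = -e (q + 1) := fun q => by linarith [hw q]
  have hw2 : ∀ q, w (q - 1) - w q = e q := fun q => by
    have := hw (q - 1)
    rw [sub_add_cancel] at this
    linarith
  have hwB := abs_le_mul_abs_of_increments (B := max |a| |b|) hw0 hw fun q =>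
    abs_le_max_abs_abs (le_max_left _ _) (max_le hab (min_le_right _ _))
  -- Clipping can raise `d q` only to `a ≤ G 0`, where `ψ₁` vanishes; otherwise it lowers the
  -- argument. The same holds for `ψ₂` with `b ≥ F 0`.
  have hclip₁ : ∀ q, ψ₁ (e q) ≤ ψ₁ (d q) := by
    intro q
    rcases le_total (min (d q) b) a with h1 | h1
    · rw [show e q = a from max_eq_left h1, hS₁.eq_zero a (min_le_right _ _)]
      exact hS₁.nonneg _
    · rw [show e q = min (d q) b from max_eq_right h1]
      exact hS₁.monotone (min_le_left _ _)
  have hclip₂ : ∀ q, ψ₂ (-e q) ≤ ψ₂ (-d q) := by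
    intro q
    rcases le_total b (d q) with h1 | h1
    · rw [show e q = b by simp only [e]; rw [min_eq_right h1, max_eq_right hab],
        hS₂.eq_zero (-b) (neg_le_neg (le_max_left _ _))]
      exact hS₂.nonneg _
    · rw [show e q = max a (d q) by simp only [e]; rw [min_eq_left h1]]
      exact hS₂.monotone (neg_le_neg (le_max_right _ _))
  have hupper : ∀ (π : SingleLinkQueue.Policy Q) (x : SingleLinkQueue.State),
      π.averageProfit x ≤ γ := fun π x =>
    π.averageProfit_le hwB (fun q lam hlam mu hmu => by
      rw [hw1, hw2]
      linarith [hmax (e (q + 1)) (e q) lam hlam mu hmu, hclip₁ q, hclip₂ (q + 1), hdeq q])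
      (fun lam hlam mu hmu => by simpa using hmax 0 0 lam hlam mu hmu) x
  obtain ⟨H, hH⟩ := bddAbove_of_increments hh (K := K)
    (fun q hq => (le_max_left _ _).trans (hK q hq))
    (fun q hq => (hK' q hq).trans (neg_nonpos.2 (le_max_left _ _)))
  have havg : ∀ x : SingleLinkQueue.State, (x.1 = 0 ∨ x.2 = 0) →
      p.withImmediateMatching.averageProfit x = (γ : EReal) := by
    intro x hx
    refine le_antisymm (hupper _ x)
      (SingleLinkQueue.Policy.le_averageProfit p.preserves_immediate hH ?_ hx)
    intro y hy
    have h1 := hp (SingleLinkQueue.imbalance y)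
    rw [SingleLinkQueue.abs_imbalance_eq hy] at h1
    show γ ≤ p.lam (SingleLinkQueue.imbalance y) * Q.demand (p.lam (SingleLinkQueue.imbalance y))
      - p.mu (SingleLinkQueue.imbalance y) * Q.supply (p.mu (SingleLinkQueue.imbalance y))
      - Q.holding * ((y.1 : ℝ) + y.2)
      + p.lam (SingleLinkQueue.imbalance y)
        * (h (SingleLinkQueue.imbalance y + 1) - h (SingleLinkQueue.imbalance y))
      + p.mu (SingleLinkQueue.imbalance y)
        * (h (SingleLinkQueue.imbalance y - 1) - h (SingleLinkQueue.imbalance y))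
    linarith
  have hdeq0 := hdeq 0
  simp only [Int.cast_zero, abs_zero, mul_zero, add_zero, zero_add] at hdeq0
  -- The equation at `0` bounds `ψ₂ (-d 1)` by `γ`, so the equation at `1` leaves at least `s` for
  -- `ψ₁ (d 1)`.
  have hmu_pos : 0 < m₁ (d 1) := by
    refine hm₁.rate_pos ?_
    have h1 := hdeq 1
    have h2 : ψ₂ (-d (1 + 1)) ≤ ψ₂ (-d 1) := hS₂.monotone (neg_le_neg (hd (by omega)))
    have h3 := hS₁.nonneg (d 0)
    have h4 : 0 < ψ₁ (d 1) := by
      simp at h1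
      simp at h2
      linarith
    exact h4
  have hlam_pos : 0 < m₂ (-d 0) := by
    refine hm₂.rate_pos ?_
    have h1 := hdeq (-1)
    have h2 : ψ₁ (d (-1)) ≤ ψ₁ (d 0) := hS₁.monotone (hd (by omega))
    have h3 := hS₂.nonneg (-d 1)
    have h4 : 0 < ψ₂ (-d 0) := by
      simp at h1
      linarith
    exact h4
  have hstable : p.withImmediateMatching.Stable := by
    refine p.stable_immediate (lt_min hmu_pos hlam_pos) (K := K)
      (fun q hq => (min_le_left _ _).trans (hm₁.monotone (hd hq)))
      (fun q hq => (min_le_right _ _).trans (hm₂.monotone (neg_le_neg (hd (by omega)))))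
      (fun q hq => hm₂.rate_eq_zero hneg ?_)
      (fun q hq => hm₁.rate_eq_zero Q.supply_strictMono ?_)
    · exact neg_le_neg (((le_max_left _ _).trans (le_max_right _ _)).trans (hK _ (by omega)))
    · have h1 := hK' q hq
      have h2 : -Q.supply 0 ≤ max 0 (max (Q.demand 0) (-Q.supply 0)) :=
        (le_max_right _ _).trans (le_max_right _ _)
      linarith
  refine ⟨p, ⟨hstable, fun π _ x hx => (hupper π x).trans (havg x hx).ge⟩,
    ⟨γ, h, fun q => ⟨?_, fun lam hlam mu hmu => ?_⟩, havg⟩, fun q r hqr => ?_, fun q r hqr => ?_⟩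
  · rw [hbell, hp, sub_self, zero_div, add_zero]
  · rw [hbell, hh1, hh2]
    have h1 := hmax (d (q + 1)) (d q) lam hlam mu hmu
    rw [hdeq] at h1
    linarith [div_nonpos_of_nonpos_of_nonneg (sub_nonpos.2 h1) hc.le]
  · exact Q.supply_strictMono.monotoneOn (hm₁.mem _) (hm₁.mem _) (hm₁.monotone (hd hqr))
  · exact Q.demand_strictAnti.antitoneOn (hm₂.mem _) (hm₂.mem _)
      (hm₂.monotone (neg_le_neg (hd (by omega))))
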